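/- Let $\theta=(\theta_{ij})$ be an $m\times m$ matrix with non-negative real entries, and let $\operatorname{perm}(A)=\sum_{\sigma}\prod_i a_{i\sigma(i)}$ denote the permanent of a square matrix $A$. For an integer $M\ge 1$ and a family $P=(P_{ij})_{1\le i,j\le m}$ of $M\times M$ permutation matrices, let $\theta^{\uparrow P}$ be the $mM\times mM$ block matrix whose $(i,j)$ block is $\theta_{ij}P_{ij}$. Put $$\operatorname{perm}_{\mathrm B,M}(\theta)=\Big(\frac{1}{(M!)^{m^2}}\sum_{P}\operatorname{perm}(\theta^{\uparrow P})\Big)^{1/M},\qquad \operatorname{perm}_{\mathrm B}(\theta)=\limsup_{M\to\infty}\operatorname{perm}_{\mathrm B,M}(\theta),$$ where the sum runs over all $(M!)^{m^2}$ such families $P$. Then, for every integer $M\ge 1$, $$\operatorname{perm}_{\mathrm B}(\theta)\le \operatorname{perm}_{\mathrm B,M}(\theta)\le \operatorname{perm}(\theta).$$ In particular, $\operatorname{perm}_{\mathrm B}(\theta)\le\operatorname{perm}(\theta)$. -/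

import Mathlib

/-- The `P`-lifting of an `m × m` matrix `θ`: the block matrix of size `mM × mM` whose `(i, j)` block
is `θ i j` times the `M × M` permutation matrix of `P i j`. The index `(i, a)` stands for the `a`-th
row or column inside block `i`. A block matrix of permutation matrices is given by the family of
permutations `P` that its blocks represent. -/
noncomputable def matrixLift {m M : ℕ} (θ : Matrix (Fin m) (Fin m) ℝ)
    (P : Fin m → Fin m → Equiv.Perm (Fin M)) : Matrix (Fin m × Fin M) (Fin m × Fin M) ℝ :=
  Matrix.of fun r c => θ r.1 c.1 * (P r.1 c.1).permMatrix ℝ r.2 c.2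

/-- The arithmetic average of the permanents of all liftings of `θ` of degree `M`. -/
noncomputable def averageLiftPermanent {m : ℕ} (M : ℕ) (θ : Matrix (Fin m) (Fin m) ℝ) : ℝ :=
  (∑ P : Fin m → Fin m → Equiv.Perm (Fin M), (matrixLift θ P).permanent) /
    (Fintype.card (Fin m → Fin m → Equiv.Perm (Fin M)) : ℝ)

/-- The degree-`M` Bethe permanent (of interest for `1 ≤ M`): the `M`-th root of the average
permanent of the liftings of degree `M`. -/
noncomputable def degreeBethePermanent {m : ℕ} (M : ℕ) (θ : Matrix (Fin m) (Fin m) ℝ) : ℝ :=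
  averageLiftPermanent M θ ^ (1 / (M : ℝ))

/-- The Bethe permanent: the limit superior of the degree-`M` Bethe permanents as `M → ∞`. It is
taken in the extended reals, where it exists without any boundedness assumption. -/
noncomputable def bethePermanent {m : ℕ} (θ : Matrix (Fin m) (Fin m) ℝ) : EReal :=
  Filter.limsup (fun M : ℕ => ((degreeBethePermanent M θ : ℝ) : EReal)) Filter.atTop

/-! Expanding the permanents of all degree-`M` liftings and grouping permutations by the numbers `A
i j` of rows of block `i` sent to block `j` bounds the average by `betheSum M θ`, a sum of terms
`c_M(A) θ^A` over the nonnegative integer matrices `A` with all line sums `M`.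

The upper bound is `betheSum M θ ≤ perm(θ)^M`. By induction on `M` it reduces to `c_{M+1}(A) ≤ ∑_σ
c_M(A - P_σ)`, over the `σ` supported in `A`. Up to common factors this is Schrijver's inequality `∏
(1 - a_ij) ≤ perm(a_ij (1 - a_ij))` for the doubly stochastic matrix `a = A / (M + 1)`. A partition
function of matchings, `matchingSum`, interpolates: when all edges act through free vertex weights
it is a product bounded below by weighted AM-GM, and when all are genuine edges it is the permanent.
Converting one edge is a minimization in two variables (`mul_bethePenalty_le`), made possible by the
correlation inequality `matchingSum_row_column`.

For the lower bound, apply the same estimate in degree `N` to a lifting `θ^{↑P}` of degree `M` and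
keep only the term of the lifted matrix `natLift A P`. That term is the `M`-th power of the `A`-term
`t_A` of `betheSum N θ`, so `t_A^M ≤ perm(θ^{↑P})^N` for every `P`, and averaging gives `t_A ≤
perm_{B,M}(θ)^N`. There are at most `(N + 1)^(m²)` terms, a factor that disappears after the `N`-th
root as `N → ∞`. -/

section MatchingSum

/-! ### Matching sums with vertex weights and their correlation inequalities -/

variable {R C : Type*} [DecidableEq R] [DecidableEq C]

/-- The weighted sum over all partial matchings between the rows in `L` and the columns in `S`:
a matched pair `(i, j)` contributes `w i j`, an unmatched row `y i`, an unmatched column `z j`. -/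
noncomputable def matchingSum (w : R → C → ℝ) (y : R → ℝ) (z : C → ℝ) :
    List R → Finset C → ℝ
  | [], S => ∏ j ∈ S, z j
  | i :: L, S => y i * matchingSum w y z L S + ∑ k ∈ S, w i k * matchingSum w y z L (S.erase k)

variable {w w' : R → C → ℝ} {y y' : R → ℝ} {z z' : C → ℝ}

omit [DecidableEq R] in
theorem matchingSum_nonneg (hw : ∀ i j, 0 ≤ w i j) (hy : ∀ i, 0 ≤ y i) (hz : ∀ j, 0 ≤ z j)
    (L : List R) (S : Finset C) : 0 ≤ matchingSum w y z L S := by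
  induction L generalizing S with
  | nil => exact Finset.prod_nonneg fun j _ => hz j
  | cons i L ih =>
    exact add_nonneg (mul_nonneg (hy i) (ih S))
      (Finset.sum_nonneg fun k _ => mul_nonneg (hw i k) (ih _))

omit [DecidableEq R] in
theorem matchingSum_perm {L L' : List R} (h : L.Perm L') (S : Finset C) :
    matchingSum w y z L S = matchingSum w y z L' S := by
  induction h generalizing S with
  | nil => rfl
  | cons i _ ih => simp only [matchingSum, ih]
  | swap i j L =>
    simp only [matchingSum, mul_add, Finset.sum_add_distrib, Finset.mul_sum]
    have key : ∑ k ∈ S, ∑ l ∈ S.erase k, w j k * (w i l * matchingSum w y z L ((S.erase k).erase l))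
        = ∑ k ∈ S, ∑ l ∈ S.erase k,
          w i k * (w j l * matchingSum w y z L ((S.erase k).erase l)) := by
      rw [Finset.sum_comm' (t' := S) (s' := fun l => S.erase l)]
      · refine Finset.sum_congr rfl fun k _ => Finset.sum_congr rfl fun l _ => ?_
        rw [Finset.erase_right_comm]; ring
      · intro a b; simp only [Finset.mem_erase]; tauto
    rw [key]
    have h1 : ∑ k ∈ S, w j k * (y i * matchingSum w y z L (S.erase k))
        = ∑ k ∈ S, y i * (w j k * matchingSum w y z L (S.erase k)) :=
      Finset.sum_congr rfl fun _ _ => by ring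
    have h2 : ∑ k ∈ S, w i k * (y j * matchingSum w y z L (S.erase k))
        = ∑ k ∈ S, y j * (w i k * matchingSum w y z L (S.erase k)) :=
      Finset.sum_congr rfl fun _ _ => by ring
    rw [h1, h2]; ring
  | trans _ _ ih₁ ih₂ => rw [ih₁, ih₂]

omit [DecidableEq R] in
theorem matchingSum_congr {L : List R} {S : Finset C}
    (hw : ∀ i ∈ L, ∀ j ∈ S, w i j = w' i j) (hy : ∀ i ∈ L, y i = y' i)
    (hz : ∀ j ∈ S, z j = z' j) : matchingSum w y z L S = matchingSum w' y' z' L S := by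
  induction L generalizing S with
  | nil => exact Finset.prod_congr rfl hz
  | cons i L ih =>
    simp only [matchingSum]
    rw [hy i (by simp), ih (fun a ha => hw a (by simp [ha])) (fun a ha => hy a (by simp [ha])) hz]
    congr 1
    refine Finset.sum_congr rfl fun k hk => ?_
    rw [hw i (by simp) k hk, ih (fun a ha j hj => hw a (by simp [ha]) j (Finset.mem_of_mem_erase hj))
      (fun a ha => hy a (by simp [ha])) fun j hj => hz j (Finset.mem_of_mem_erase hj)]

/-- The recursion favours rows; this restores the symmetry with columns. Induct on the rows: expand
row `i`, then column `j` in what remains; matching `i` to `j` supplies the new summand. -/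
theorem matchingSum_column {L : List R} (hL : L.Nodup) {S : Finset C} {j : C} (hj : j ∈ S) :
    matchingSum w y z L S = z j * matchingSum w y z L (S.erase j) +
      ∑ i ∈ L.toFinset, w i j * matchingSum w y z (L.erase i) (S.erase j) := by
  induction L generalizing S with
  | nil => simp [matchingSum, Finset.mul_prod_erase _ _ hj]
  | cons i L ih =>
    have hiL : i ∉ L := (List.nodup_cons.1 hL).1
    have ih' := fun {S : Finset C} (h : j ∈ S) => ih (List.nodup_cons.1 hL).2 (S := S) h
    rw [List.toFinset_cons, Finset.sum_insert (by simpa using hiL), List.erase_cons_head]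
    have h1 : ∑ a ∈ L.toFinset, w a j * matchingSum w y z ((i :: L).erase a) (S.erase j) =
        ∑ a ∈ L.toFinset, (y i * (w a j * matchingSum w y z (L.erase a) (S.erase j)) +
          ∑ k ∈ S.erase j,
            w i k * (w a j * matchingSum w y z (L.erase a) ((S.erase k).erase j))) := by
      refine Finset.sum_congr rfl fun a ha => ?_
      have hai : i ≠ a := by rintro rfl; exact hiL (by simpa using ha)
      rw [List.erase_cons_tail (by simpa using hai)]
      simp only [matchingSum, mul_add, Finset.mul_sum]
      congr 1
      · ring
      · exact Finset.sum_congr rfl fun k _ => by rw [Finset.erase_right_comm]; ring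
    rw [h1, Finset.sum_add_distrib, Finset.sum_comm]
    simp only [← Finset.mul_sum]
    simp only [matchingSum]
    rw [ih' hj, ← Finset.add_sum_erase _ _ hj]
    have h2 : ∑ k ∈ S.erase j, w i k * matchingSum w y z L (S.erase k) =
        ∑ k ∈ S.erase j, (z j * (w i k * matchingSum w y z L ((S.erase j).erase k)) + w i k *
          ∑ a ∈ L.toFinset, w a j * matchingSum w y z (L.erase a) ((S.erase k).erase j)) := by
      refine Finset.sum_congr rfl fun k hk => ?_
      rw [ih' (Finset.mem_erase.2 ⟨(Finset.ne_of_mem_erase hk).symm, hj⟩), Finset.erase_right_comm]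
      ring
    rw [h2, Finset.sum_add_distrib, ← Finset.mul_sum]
    ring

theorem matchingSum_row {L : List R} {i : R} (hi : i ∈ L) (S : Finset C) :
    matchingSum w y z L S = y i * matchingSum w y z (L.erase i) S +
      ∑ k ∈ S, w i k * matchingSum w y z (L.erase i) (S.erase k) :=
  matchingSum_perm (List.perm_cons_erase hi) S

/-- Deleting a row and deleting a column are positively correlated. -/
theorem matchingSum_row_column_of_columns {L : List R} {i : R} (hi : i ∈ L)
    {S : Finset C} {j : C} (hj : j ∈ S)
    (hw : ∀ i j, 0 ≤ w i j)
    (h : ∀ k ∈ S.erase j, matchingSum w y z (L.erase i) S *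
        matchingSum w y z (L.erase i) ((S.erase j).erase k) ≤
      matchingSum w y z (L.erase i) (S.erase j) * matchingSum w y z (L.erase i) (S.erase k)) :
    matchingSum w y z (L.erase i) S * matchingSum w y z L (S.erase j) ≤
      matchingSum w y z L S * matchingSum w y z (L.erase i) (S.erase j) := by
  -- After expansion along row `i` the `y i` terms cancel, the column `k = j` leaves a nonnegative
  -- square, and the other columns are covered by `h`.
  rw [matchingSum_row hi S, matchingSum_row hi (S.erase j), ← Finset.add_sum_erase _ _ hj]
  have h1 : matchingSum w y z (L.erase i) S *
        ∑ k ∈ S.erase j, w i k * matchingSum w y z (L.erase i) ((S.erase j).erase k) ≤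
      matchingSum w y z (L.erase i) (S.erase j) *
        ∑ k ∈ S.erase j, w i k * matchingSum w y z (L.erase i) (S.erase k) := by
    rw [Finset.mul_sum, Finset.mul_sum]
    refine Finset.sum_le_sum fun k hk => ?_
    have := mul_le_mul_of_nonneg_left (h k hk) (hw i k)
    linarith
  have h2 := mul_nonneg (hw i j) (mul_self_nonneg (matchingSum w y z (L.erase i) (S.erase j)))
  nlinarith

/-- Deleting two columns: negative correlation. -/
theorem matchingSum_columns (hw : ∀ i j, 0 ≤ w i j) {L : List R} (hL : L.Nodup) {S : Finset C}
    {j k : C} (hj : j ∈ S) (hk : k ∈ S.erase j) :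
    matchingSum w y z L S * matchingSum w y z L ((S.erase j).erase k) ≤
      matchingSum w y z L (S.erase j) * matchingSum w y z L (S.erase k) := by
  -- Both correlations are proved in one induction on the number of rows: the column statement with
  -- one row fewer yields the row-column statement used here.
  induction hn : L.length generalizing L S j k with
  | zero =>
    obtain rfl := List.eq_nil_of_length_eq_zero hn
    simp only [matchingSum]
    rw [← Finset.mul_prod_erase S z hj, ← Finset.mul_prod_erase (S.erase k) z (a := j)
      (Finset.mem_erase.2 ⟨(Finset.ne_of_mem_erase hk).symm, hj⟩), Finset.erase_right_comm]
    exact le_of_eq (by ring)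
  | succ n ih =>
    have hj' : j ∈ S.erase k := Finset.mem_erase.2 ⟨(Finset.ne_of_mem_erase hk).symm, hj⟩
    rw [matchingSum_column hL hj, matchingSum_column hL hj', Finset.erase_right_comm (a := k)]
    have h1 : (∑ i ∈ L.toFinset, w i j * matchingSum w y z (L.erase i) (S.erase j)) *
          matchingSum w y z L ((S.erase j).erase k) ≤
        (∑ i ∈ L.toFinset, w i j * matchingSum w y z (L.erase i) ((S.erase j).erase k)) *
          matchingSum w y z L (S.erase j) := by
      rw [Finset.sum_mul, Finset.sum_mul]
      refine Finset.sum_le_sum fun i hi => ?_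
      have hi' : i ∈ L := by simpa using hi
      have h := matchingSum_row_column_of_columns (y := y) (z := z) hi' hk hw fun l hl =>
        ih (hL.erase i) hk hl (by rw [List.length_erase_of_mem hi', hn]; rfl)
      have := mul_le_mul_of_nonneg_left h (hw i j)
      linarith
    linarith

theorem matchingSum_row_column (hw : ∀ i j, 0 ≤ w i j) {L : List R} (hL : L.Nodup) {S : Finset C}
    {i : R} (hi : i ∈ L) {j : C} (hj : j ∈ S) :
    matchingSum w y z (L.erase i) S * matchingSum w y z L (S.erase j) ≤
      matchingSum w y z L S * matchingSum w y z (L.erase i) (S.erase j) :=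
  matchingSum_row_column_of_columns hi hj hw fun _ hk =>
    matchingSum_columns hw (hL.erase i) hj hk

/-- Matching sums are affine in each single weight, the slope being the sum with the corresponding
vertices deleted. -/
theorem matchingSum_change_row_weight {L : List R} (hL : L.Nodup) {i : R} (hi : i ∈ L)
    (hy : ∀ a, a ≠ i → y' a = y a) (S : Finset C) :
    matchingSum w y' z L S =
      matchingSum w y z L S + (y' i - y i) * matchingSum w y z (L.erase i) S := by
  have h : ∀ S, matchingSum w y' z (L.erase i) S = matchingSum w y z (L.erase i) S := fun S =>
    matchingSum_congr (fun _ _ _ _ => rfl)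
      (fun a ha => hy a (by rintro rfl; exact hL.not_mem_erase ha)) fun _ _ => rfl
  simp only [matchingSum_row hi, h]
  ring

theorem matchingSum_change_column_weight {L : List R} (hL : L.Nodup) {S : Finset C} {j : C}
    (hj : j ∈ S) (hz : ∀ a, a ≠ j → z' a = z a) :
    matchingSum w y z' L S =
      matchingSum w y z L S + (z' j - z j) * matchingSum w y z L (S.erase j) := by
  have h : ∀ L, matchingSum w y z' L (S.erase j) = matchingSum w y z L (S.erase j) := fun L =>
    matchingSum_congr (fun _ _ _ _ => rfl) (fun _ _ => rfl)
      fun a ha => hz a (Finset.ne_of_mem_erase ha)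
  simp only [matchingSum_column hL hj, h]
  ring

theorem matchingSum_change_edge_weight {L : List R} (hL : L.Nodup) {S : Finset C} {i : R} {j : C}
    (hi : i ∈ L) (hj : j ∈ S) (hw : ∀ a b, (a, b) ≠ (i, j) → w' a b = w a b) :
    matchingSum w' y z L S =
      matchingSum w y z L S + (w' i j - w i j) * matchingSum w y z (L.erase i) (S.erase j) := by
  have h : ∀ S, matchingSum w' y z (L.erase i) S = matchingSum w y z (L.erase i) S := fun S =>
    matchingSum_congr (fun a ha b _ => hw a b (by
      intro he; rw [(Prod.mk.inj he).1] at ha; exact hL.not_mem_erase ha))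
      (fun _ _ => rfl) fun _ _ => rfl
  have h1 : ∑ k ∈ S.erase j, w' i k * matchingSum w y z (L.erase i) (S.erase k) =
      ∑ k ∈ S.erase j, w i k * matchingSum w y z (L.erase i) (S.erase k) :=
    Finset.sum_congr rfl fun k hk => by
      rw [hw i k (by simpa using Finset.ne_of_mem_erase hk)]
  simp only [matchingSum_row hi, h]
  rw [← Finset.add_sum_erase _ _ hj, ← Finset.add_sum_erase _ _ hj, h1]
  ring

omit [DecidableEq R] in
theorem matchingSum_of_edge_weight_eq_zero (hw : ∀ i j, w i j = 0) (L : List R) (S : Finset C) :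
    matchingSum w y z L S = (L.map y).prod * ∏ j ∈ S, z j := by
  induction L generalizing S with
  | nil => simp [matchingSum]
  | cons i L ih => simp [matchingSum, hw, ih, mul_assoc]

omit [DecidableEq R] in
-- Zero vertex weights leave only perfect matchings. The recursion then parallels
-- `Equiv.Perm.decomposeFin`: the image of `0`, followed by a permutation of the rest relabelled by
-- a swap.
theorem matchingSum_ofFn (w : R → C → ℝ) {n : ℕ} (r : Fin n → R) (c : Fin n → C)
    (hc : Function.Injective c) :
    matchingSum w 0 0 (List.ofFn r) (Finset.univ.image c) =
      ∑ σ : Equiv.Perm (Fin n), ∏ i, w (r i) (c (σ i)) := by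
  induction n with
  | zero => simp [matchingSum]
  | succ n ih =>
    rw [List.ofFn_succ, matchingSum, Finset.sum_image hc.injOn,
      ← Equiv.Perm.decomposeFin.symm.sum_comp, Fintype.sum_prod_type]
    simp only [Pi.zero_apply, zero_mul, zero_add]
    refine Finset.sum_congr rfl fun k _ => ?_
    have him : (Finset.univ.image c).erase (c k) =
        Finset.univ.image fun i : Fin n => c (Equiv.swap 0 k i.succ) := by
      have h2 : Finset.univ.image c = Finset.univ.image (fun i => c (Equiv.swap 0 k i)) := by
        ext x
        simp only [Finset.mem_image, Finset.mem_univ, true_and]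
        exact ((Equiv.swap 0 k).exists_congr_left (p := fun a => c a = x)).trans (by simp)
      ext x
      rw [h2]
      simp only [Finset.mem_erase, Finset.mem_image, Finset.mem_univ, true_and, Fin.exists_fin_succ,
        Equiv.swap_apply_left]
      constructor
      · rintro ⟨h, h' | h'⟩
        · exact absurd h'.symm h
        · exact h'
      · rintro ⟨i, rfl⟩
        refine ⟨fun h => ?_, Or.inr ⟨i, rfl⟩⟩
        have := hc h
        rw [← Equiv.swap_apply_left 0 k] at this
        exact Fin.succ_ne_zero i ((Equiv.swap 0 k).injective (by simpa using this))
    rw [him, ih (fun i => r i.succ) (fun i => c (Equiv.swap 0 k i.succ))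
      (hc.comp ((Equiv.swap 0 k).injective.comp (Fin.succ_injective n))), Finset.mul_sum]
    refine Finset.sum_congr rfl fun σ _ => ?_
    rw [Fin.prod_univ_succ]
    simp

end MatchingSum

theorem matchingSum_eq_permanent {ι : Type*} [Fintype ι] [DecidableEq ι] (w : ι → ι → ℝ) :
    matchingSum w 0 0 Finset.univ.toList Finset.univ = Matrix.permanent (Matrix.of w) := by
  obtain ⟨n, ⟨e⟩⟩ : ∃ n, Nonempty (Fin n ≃ ι) := ⟨_, ⟨(Fintype.equivFin ι).symm⟩⟩
  have hperm : (Finset.univ : Finset ι).toList.Perm (List.ofFn e) := by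
    refine (List.perm_ext_iff_of_nodup (Finset.nodup_toList _)
      (List.nodup_ofFn.2 e.injective)).2 fun a => ?_
    simpa [List.mem_ofFn] using e.surjective a
  have hcol : (Finset.univ : Finset ι) = Finset.univ.image e := by
    ext x; simp
  rw [matchingSum_perm hperm, hcol, matchingSum_ofFn w e e e.injective, ← Matrix.permanent_transpose,
    Matrix.permanent, ← e.permCongr.sum_comp]
  refine Finset.sum_congr rfl fun σ _ => ?_
  rw [← e.prod_comp]
  simp [Equiv.permCongr_apply]

/-! ### The two-variable minimization -/

/-- `1 - a`, except that the value at `a = 1` is `1`. -/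
noncomputable def bethePenalty (a : ℝ) : ℝ := if a = 1 then 1 else 1 - a

theorem bethePenalty_pos {a : ℝ} (h : a ≤ 1) : 0 < bethePenalty a := by
  unfold bethePenalty
  split_ifs with h1
  · exact one_pos
  · exact sub_pos.2 (lt_of_le_of_ne h h1)

/-- The case `0 < a < 1` of `mul_bethePenalty_le`, for positive coefficients and
`b * c = p * d`. -/
theorem mul_one_sub_le_of_forall {a p b d K : ℝ} (ha : 0 < a) (ha1 : a < 1) (hp : 0 < p)
    (hb : 0 < b) (hd : 0 < d)
    (h : ∀ u v : ℝ, 0 < u → 0 < v →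
      K * (u * v) ^ a ≤ p + a * b * u + a * (p * d / b) * v + a ^ 2 * d * (u * v)) :
    K * (1 - a) ≤ p + a * (1 - a) * d := by
  have ha' : 0 < 1 - a := sub_pos.2 ha1
  -- When `b * c = p * d` the bilinear form is `(p + a b u)(p + a c v) / p`; these `u` and `v`
  -- minimize its quotient by `(u v)^a`.
  have hK := h (p / (b * (1 - a))) (b / (d * (1 - a))) (by positivity) (by positivity)
  have huv : p / (b * (1 - a)) * (b / (d * (1 - a))) = p / (1 - a) ^ 2 / d := by
    field_simp
  rw [huv] at hK
  have hval : p + a * b * (p / (b * (1 - a))) + a * (p * d / b) * (b / (d * (1 - a))) +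
      a ^ 2 * d * (p / (1 - a) ^ 2 / d) = p / (1 - a) ^ 2 := by
    field_simp
    ring
  rw [hval] at hK
  set q := p / (1 - a) ^ 2 with hq
  have hq0 : 0 < q := by positivity
  have hgm := Real.geom_mean_le_arith_mean2_weighted ha'.le ha.le hq0.le hd.le (by ring)
  have hsplit : q = q ^ (1 - a) * d ^ a * (q / d) ^ a := by
    rw [Real.div_rpow hq0.le hd.le, Real.rpow_sub hq0, Real.rpow_one]
    field_simp
  have hqd : 0 < (q / d) ^ a := Real.rpow_pos_of_pos (by positivity) a
  have hK2 : K ≤ q ^ (1 - a) * d ^ a := le_of_mul_le_mul_right (hK.trans_eq hsplit) hqd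
  have hpq : (1 - a) * q = p / (1 - a) := by rw [hq]; field_simp
  have h3 : K ≤ p / (1 - a) + a * d := by linarith
  calc K * (1 - a) ≤ (p / (1 - a) + a * d) * (1 - a) := mul_le_mul_of_nonneg_right h3 ha'.le
    _ = p + a * (1 - a) * d := by field_simp

/-- Replaces the free weights `u`, `v` of an edge by an edge weight. For `0 < a < 1`, perturbation
makes the coefficients positive, and `b * c ≤ p * d` lets `c` be raised until equality holds. -/
theorem mul_bethePenalty_le {a p b c d K : ℝ} (ha : 0 ≤ a) (ha1 : a ≤ 1) (hp : 0 ≤ p)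
    (hb : 0 ≤ b) (hc : 0 ≤ c) (hd : 0 ≤ d) (hbc : b * c ≤ p * d)
    (h : ∀ u v : ℝ, 0 < u → 0 < v →
      K * (u * v) ^ a ≤ p + a * b * u + a * c * v + a ^ 2 * d * (u * v)) :
    K * bethePenalty a ≤ p + a * bethePenalty a * d := by
  unfold bethePenalty
  split_ifs with h1
  · subst h1
    refine le_of_forall_pos_le_add fun ε hε => ?_
    -- For `a = 1`, send `u = v = t` to infinity; this `t` is large enough for the lower-order terms
    -- to cost at most `ε t²`.
    set t := (p + b + c) / ε + 1 with ht
    have ht1 : 1 ≤ t := by rw [ht]; have : 0 ≤ (p + b + c) / ε := by positivity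
                           linarith
    have ht0 : 0 < t := by linarith
    have h2 := h t t ht0 ht0
    simp only [Real.rpow_one, one_mul, one_pow] at h2
    have h3 : p + b + c ≤ ε * t := by
      rw [ht, mul_add, mul_div_cancel₀ _ hε.ne']; linarith
    have h4 : p + b * t + c * t ≤ ε * t * t := by
      have h5 : p ≤ p * t := le_mul_of_one_le_right hp ht1
      have h6 := mul_le_mul_of_nonneg_right h3 ht0.le
      linarith
    have h7 : K * (t * t) ≤ (d + ε) * (t * t) := by linarith
    have h8 := le_of_mul_le_mul_right h7 (by positivity)
    linarith
  · have ha1' : a < 1 := lt_of_le_of_ne ha1 h1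
    rcases ha.eq_or_lt with rfl | ha0
    · have := h 1 1 one_pos one_pos
      simp only [mul_one, Real.rpow_zero] at this
      linarith
    refine le_of_forall_pos_le_add fun ε hε => ?_
    set η := ε / 2 with hη
    have hη0 : 0 < η := by positivity
    -- Positive, yet so close to `b` that `b' * c ≤ b * c + η²`, which stays below `(p + η) * (d +
    -- η)`.
    set b' := b + η ^ 2 / (c + 1) with hb'
    have hb0 : 0 < b' := by positivity
    have hbb : b ≤ b' := by rw [hb']; have : 0 ≤ η ^ 2 / (c + 1) := by positivity
                            linarith
    have hcc : c ≤ (p + η) * (d + η) / b' := by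
      rw [le_div_iff₀ hb0, hb']
      have h5 : c * (η ^ 2 / (c + 1)) ≤ η ^ 2 := by
        rw [mul_div_assoc', div_le_iff₀ (by positivity)]
        nlinarith [sq_nonneg η]
      have h6 : 0 ≤ p * η := by positivity
      have h7 : 0 ≤ η * d := by positivity
      nlinarith
    have := mul_one_sub_le_of_forall (a := a) (p := p + η) (b := b') (d := d + η) (K := K)
      ha0 ha1' (by positivity) hb0 (by positivity) fun u v hu hv => (h u v hu hv).trans (by
        have h8 : a * b * u ≤ a * b' * u := by gcongr
        have h9 : a * c * v ≤ a * ((p + η) * (d + η) / b') * v := by gcongr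
        have h10 : a ^ 2 * d * (u * v) ≤ a ^ 2 * (d + η) * (u * v) := by gcongr; linarith
        linarith)
    have h11 : a * (1 - a) * η ≤ η := by
      have : a * (1 - a) ≤ 1 := by nlinarith
      nlinarith
    have h12 : ε = η + η := by rw [hη]; ring
    rw [mul_add] at this
    linarith

theorem prod_rpow_le_of_row_sum {κ ι : Type*} [Fintype ι] [Fintype κ] {A u : κ → ι → ℝ}
    (hA : ∀ i j, 0 ≤ A i j) (hrow : ∀ i, ∑ j, A i j = 1) (hu : ∀ i j, 0 < u i j) :
    ∏ i, ∏ j, u i j ^ A i j ≤ ∏ i, ∑ j, A i j * u i j :=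
  Finset.prod_le_prod (fun i _ => Finset.prod_nonneg fun j _ => Real.rpow_nonneg (hu i j).le _)
    fun i _ => Real.geom_mean_le_arith_mean_weighted _ _ _ (fun j _ => hA i j) (hrow i)
      fun j _ => (hu i j).le

/-! ### Schrijver's inequality -/

section Schrijver

variable {ι : Type*} [Fintype ι] [DecidableEq ι]

/-- Intermediate inequality: the edges in `T` carry weights, the remaining ones contribute to the
vertex weights. -/
theorem prod_le_matchingSum_of_doublyStochastic {A : ι → ι → ℝ} (hA : ∀ i j, 0 ≤ A i j)
    (hrow : ∀ i, ∑ j, A i j = 1) (hcol : ∀ j, ∑ i, A i j = 1) (T : Finset (ι × ι))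
    (u v : ι → ι → ℝ) (hu : ∀ i j, 0 < u i j) (hv : ∀ i j, 0 < v i j) :
    ∏ e : ι × ι, (if e ∈ T then bethePenalty (A e.1 e.2)
        else (u e.1 e.2 * v e.1 e.2) ^ A e.1 e.2) ≤
      matchingSum (fun i j => if (i, j) ∈ T then A i j * bethePenalty (A i j) else 0)
        (fun i => ∑ j, if (i, j) ∈ T then 0 else A i j * u i j)
        (fun j => ∑ i, if (i, j) ∈ T then 0 else A i j * v i j)
        Finset.univ.toList Finset.univ := by
  have hA1 : ∀ i j, A i j ≤ 1 := fun i j =>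
    (Finset.single_le_sum (fun k _ => hA i k) (Finset.mem_univ j)).trans_eq (hrow i)
  induction T using Finset.induction_on generalizing u v with
  | empty =>
    simp only [Finset.notMem_empty, if_false]
    -- Without edges the matching sum is the product of all vertex weights; weighted AM-GM applies
    -- to each row and each column.
    rw [matchingSum_of_edge_weight_eq_zero (fun _ _ => rfl), Finset.prod_map_toList,
      Fintype.prod_prod_type]
    simp only [Real.mul_rpow (hu _ _).le (hv _ _).le, Finset.prod_mul_distrib]
    refine mul_le_mul (prod_rpow_le_of_row_sum hA hrow hu) ?_
      (Finset.prod_nonneg fun i _ => Finset.prod_nonneg fun j _ => Real.rpow_nonneg (hv i j).le _)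
      (Finset.prod_nonneg fun i _ => Finset.sum_nonneg fun j _ =>
        mul_nonneg (hA i j) (hu i j).le)
    rw [Finset.prod_comm]
    exact prod_rpow_le_of_row_sum (A := fun j i => A i j) (u := fun j i => v i j)
      (fun j i => hA i j) hcol fun j i => hv i j
  | insert e T he ih =>
    obtain ⟨i, j⟩ := e
    set L : List ι := Finset.univ.toList with hLdef
    have hL : L.Nodup := Finset.nodup_toList _
    have hi : i ∈ L := by simp [hLdef]
    have hj : j ∈ (Finset.univ : Finset ι) := Finset.mem_univ j
    set w : ι → ι → ℝ := fun i j => if (i, j) ∈ T then A i j * bethePenalty (A i j) else 0 with hw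
    set y : ι → ℝ := fun a => ∑ b, if (a, b) ∈ insert (i, j) T then 0 else A a b * u a b with hy
    set z : ι → ℝ := fun b => ∑ a, if (a, b) ∈ insert (i, j) T then 0 else A a b * v a b with hz
    have hw0 : ∀ a b, 0 ≤ w a b := fun a b => by
      simp only [hw]; split_ifs
      · exact mul_nonneg (hA a b) (bethePenalty_pos (hA1 a b)).le
      · exact le_rfl
    have hy0 : ∀ a, 0 ≤ y a := fun a => Finset.sum_nonneg fun b _ => by
      split_ifs
      · exact le_rfl
      · exact mul_nonneg (hA a b) (hu a b).le
    have hz0 : ∀ a, 0 ≤ z a := fun a => Finset.sum_nonneg fun b _ => by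
      split_ifs
      · exact le_rfl
      · exact mul_nonneg (hA _ _) (hv _ _).le
    rw [matchingSum_change_edge_weight (w := w) hL hi hj (fun a b hab => by
      simp only [hw, Finset.mem_insert, hab, false_or])]
    have hwe : w i j = 0 := by simp only [hw, he, if_false]
    rw [hwe, if_pos (Finset.mem_insert_self _ _), sub_zero,
      ← Finset.mul_prod_erase _ _ (Finset.mem_univ (i, j)), if_pos (Finset.mem_insert_self _ _),
      mul_comm]
    refine mul_bethePenalty_le (hA i j) (hA1 i j) (matchingSum_nonneg hw0 hy0 hz0 _ _)
      (matchingSum_nonneg hw0 hy0 hz0 (L.erase i) Finset.univ)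
      (matchingSum_nonneg hw0 hy0 hz0 L (Finset.univ.erase j)) (matchingSum_nonneg hw0 hy0 hz0 _ _)
      (matchingSum_row_column hw0 hL hi hj) fun p q hp hq => ?_
    -- Give the edge `(i, j)` arbitrary weights `p`, `q`: the induction hypothesis becomes a bound
    -- on a form bilinear in `p`, `q`, whose coefficients are the matching sums with row `i`, column
    -- `j`, both or neither deleted.
    set u' : ι → ι → ℝ := fun a b => if (a, b) = (i, j) then p else u a b with hu'
    set v' : ι → ι → ℝ := fun a b => if (a, b) = (i, j) then q else v a b with hv'
    have key := ih u' v' (fun a b => by simp only [hu']; split_ifs; exacts [hp, hu a b])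
      (fun a b => by simp only [hv']; split_ifs; exacts [hq, hv a b])
    set y' : ι → ℝ := fun a => ∑ b, if (a, b) ∈ T then 0 else A a b * u' a b with hy'
    set z' : ι → ℝ := fun b => ∑ a, if (a, b) ∈ T then 0 else A a b * v' a b with hz'
    have hyi : y' i - y i = A i j * p := by
      simp only [hy, hy']
      rw [← Finset.sum_sub_distrib, Finset.sum_eq_single j]
      · simp [he, hu']
      · intro b _ hb
        simp [hb, hu']
      · simp
    have hzj : z' j - z j = A i j * q := by
      simp only [hz, hz']
      rw [← Finset.sum_sub_distrib, Finset.sum_eq_single i]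
      · simp [he, hv']
      · intro b _ hb
        simp [hb, hv']
      · simp
    have hyne : ∀ a, a ≠ i → y' a = y a := fun a ha => by
      simp [hy, hy', hu', ha]
    have hzne : ∀ a, a ≠ j → z' a = z a := fun a ha => by
      simp [hz, hz', hv', ha]
    rw [← Finset.mul_prod_erase _ _ (Finset.mem_univ (i, j)), if_neg he,
      matchingSum_change_row_weight hL hi hyne, matchingSum_change_column_weight hL hj hzne,
      matchingSum_change_column_weight (hL.erase i) hj hzne, hyi, hzj] at key
    have hprod : ∏ e ∈ Finset.univ.erase (i, j), (if e ∈ insert (i, j) T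
          then bethePenalty (A e.1 e.2) else (u e.1 e.2 * v e.1 e.2) ^ A e.1 e.2) =
        ∏ e ∈ Finset.univ.erase (i, j), (if e ∈ T then bethePenalty (A e.1 e.2)
          else (u' e.1 e.2 * v' e.1 e.2) ^ A e.1 e.2) := by
      refine Finset.prod_congr rfl fun e hee => ?_
      have hne := Finset.ne_of_mem_erase hee
      simp only [Finset.mem_insert, hne, false_or, hu', hv', Prod.mk.eta, if_false]
    rw [hprod]
    have hpq : (u' i j * v' i j) ^ A i j = (p * q) ^ A i j := by simp [hu', hv']
    simp only [hpq] at key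
    refine (le_of_eq (mul_comm _ _)).trans (key.trans (le_of_eq ?_))
    ring

/-- **Schrijver's permanental inequality** for doubly stochastic matrices. -/
theorem prod_bethePenalty_le_permanent {A : ι → ι → ℝ} (hA : ∀ i j, 0 ≤ A i j)
    (hrow : ∀ i, ∑ j, A i j = 1) (hcol : ∀ j, ∑ i, A i j = 1) :
    ∏ i, ∏ j, bethePenalty (A i j) ≤
      Matrix.permanent (Matrix.of fun i j => A i j * bethePenalty (A i j)) := by
  have h := prod_le_matchingSum_of_doublyStochastic hA hrow hcol Finset.univ (fun _ _ => 1)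
    (fun _ _ => 1) (fun _ _ => one_pos) (fun _ _ => one_pos)
  simp only [Finset.mem_univ, if_true, Finset.sum_const_zero, Fintype.prod_prod_type] at h
  rw [← matchingSum_eq_permanent]
  exact h

end Schrijver

/-! ### Bethe coefficients and the bound by powers of the permanent -/

open Nat in
/-- The factor contributed by an entry `a` to the coefficient `betheCoeff`. -/
noncomputable def betheFactor (M a : ℕ) : ℝ := ((M - a)! : ℝ) / ((M ! : ℝ) * (a ! : ℝ))

theorem betheFactor_nonneg (M a : ℕ) : 0 ≤ betheFactor M a := by
  unfold betheFactor; positivity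

theorem betheFactor_zero (M : ℕ) : betheFactor M 0 = 1 := by
  have : (M.factorial : ℝ) ≠ 0 := by positivity
  simp [betheFactor, this]

/-- Since `a ≤ M`, the exceptional value of `bethePenalty` is not met, and `1 - a / (M + 1)` is the
ratio of consecutive factors. -/
theorem betheFactor_mul_bethePenalty {M a : ℕ} (h : a ≤ M) :
    betheFactor M a * bethePenalty (a / (M + 1 : ℕ)) = betheFactor (M + 1) a := by
  have hM : ((M + 1 : ℕ) : ℝ) ≠ 0 := by positivity
  have hne : (a : ℝ) / (M + 1 : ℕ) ≠ 1 := by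
    rw [Ne, div_eq_one_iff_eq hM]
    exact_mod_cast (by omega : a ≠ M + 1)
  rw [bethePenalty, if_neg hne, betheFactor, betheFactor, Nat.succ_sub h, Nat.factorial_succ,
    Nat.factorial_succ]
  have h1 : (M.factorial : ℝ) ≠ 0 := by positivity
  have h2 : (a.factorial : ℝ) ≠ 0 := by positivity
  push_cast [Nat.cast_sub h] at hM ⊢
  field_simp
  ring

theorem betheFactor_succ (M a : ℕ) :
    betheFactor M a =
      betheFactor (M + 1) (a + 1) * (((M + 1 : ℕ) : ℝ) ^ 2 * (((a + 1 : ℕ) : ℝ) / (M + 1 : ℕ))) := by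
  have h1 : (M.factorial : ℝ) ≠ 0 := by positivity
  have h2 : (a.factorial : ℝ) ≠ 0 := by positivity
  rw [betheFactor, betheFactor, Nat.add_sub_add_right, Nat.factorial_succ, Nat.factorial_succ]
  push_cast
  field_simp

section BetheSum

variable {ι : Type*} [Fintype ι] [DecidableEq ι]

open Nat in
/-- The coefficient of `∏ θ i j ^ A i j` in the `M`-th power of the degree-`M` Bethe permanent. -/
noncomputable def betheCoeff (M : ℕ) (A : ι → ι → ℕ) : ℝ :=
  ((M ! : ℝ) ^ 2) ^ Fintype.card ι * ∏ i, ∏ j, betheFactor M (A i j)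

omit [DecidableEq ι] in
theorem betheCoeff_nonneg (M : ℕ) (A : ι → ι → ℕ) : 0 ≤ betheCoeff M A :=
  mul_nonneg (by positivity) (Finset.prod_nonneg fun _ _ => Finset.prod_nonneg fun _ _ =>
    betheFactor_nonneg _ _)

variable (ι) in
/-- The matrices of natural numbers all of whose row and column sums are `M`. -/
def lineSumMatrices (M : ℕ) : Finset (ι → ι → ℕ) :=
  {A ∈ Fintype.piFinset fun _ : ι => Fintype.piFinset fun _ : ι => Finset.range (M + 1) |
    (∀ i, ∑ j, A i j = M) ∧ ∀ j, ∑ i, A i j = M}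

theorem mem_lineSumMatrices {M : ℕ} {A : ι → ι → ℕ} :
    A ∈ lineSumMatrices ι M ↔ (∀ i, ∑ j, A i j = M) ∧ ∀ j, ∑ i, A i j = M := by
  simp only [lineSumMatrices, Finset.mem_filter, Fintype.mem_piFinset, Finset.mem_range,
    and_iff_right_iff_imp]
  rintro ⟨h, -⟩ i j
  exact Nat.lt_succ_of_le
    ((Finset.single_le_sum (fun _ _ => Nat.zero_le _) (Finset.mem_univ j)).trans_eq (h i))

theorem card_lineSumMatrices_le (M : ℕ) :
    (lineSumMatrices ι M).card ≤ (M + 1) ^ (Fintype.card ι * Fintype.card ι) := by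
  refine (Finset.card_filter_le _ _).trans (le_of_eq ?_)
  simp [Fintype.card_piFinset, pow_mul]

/-- The sum over all nonnegative integer matrices with line sums `M` that equals the `M`-th power of
the degree-`M` Bethe permanent. -/
noncomputable def betheSum (M : ℕ) (θ : Matrix ι ι ℝ) : ℝ :=
  ∑ A ∈ lineSumMatrices ι M, betheCoeff M A * ∏ i, ∏ j, θ i j ^ A i j

/-- The matrix `A` minus the permutation matrix of `σ`. -/
def subPermMatrix (A : ι → ι → ℕ) (σ : Equiv.Perm ι) : ι → ι → ℕ :=
  fun i j => A i j - if σ i = j then 1 else 0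

omit [Fintype ι] in
theorem subPermMatrix_add {A : ι → ι → ℕ} {σ : Equiv.Perm ι} (h : ∀ i, A i (σ i) ≠ 0) (i j : ι) :
    subPermMatrix A σ i j + (if σ i = j then 1 else 0) = A i j := by
  unfold subPermMatrix
  split_ifs with hj
  · subst hj; exact Nat.sub_add_cancel (Nat.one_le_iff_ne_zero.2 (h i))
  · rfl

theorem subPermMatrix_mem {M : ℕ} {A : ι → ι → ℕ} (hA : A ∈ lineSumMatrices ι (M + 1))
    {σ : Equiv.Perm ι} (h : ∀ i, A i (σ i) ≠ 0) : subPermMatrix A σ ∈ lineSumMatrices ι M := by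
  rw [mem_lineSumMatrices] at hA ⊢
  refine ⟨fun i => ?_, fun j => ?_⟩
  · have := hA.1 i
    simp only [← subPermMatrix_add h i, Finset.sum_add_distrib, Finset.sum_ite_eq,
      Finset.mem_univ, if_true] at this
    omega
  · have := hA.2 j
    simp only [← subPermMatrix_add h _ j, Finset.sum_add_distrib, ← Equiv.eq_symm_apply,
      Finset.sum_ite_eq', Finset.mem_univ, if_true] at this
    omega

/-- Row by row: off `σ` the penalty raises `M` to `M + 1`, while at `(i, σ i)` the entry also drops
by one. An entry equal to `M + 1` can only sit at `(i, σ i)`, where the penalty is never evaluated.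
-/
theorem betheCoeff_subPermMatrix {M : ℕ} {A : ι → ι → ℕ} (hA : A ∈ lineSumMatrices ι (M + 1))
    {σ : Equiv.Perm ι} (h : ∀ i, A i (σ i) ≠ 0) :
    betheCoeff M (subPermMatrix A σ) * ∏ i, ∏ j, bethePenalty (A i j / (M + 1 : ℕ)) =
      betheCoeff (M + 1) A *
        ∏ i, ((A i (σ i) : ℝ) / (M + 1 : ℕ) * bethePenalty (A i (σ i) / (M + 1 : ℕ))) := by
  rw [mem_lineSumMatrices] at hA
  have hrow : ∀ i, (M.factorial : ℝ) ^ 2 * ((∏ j, betheFactor M (subPermMatrix A σ i j)) *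
      ∏ j, bethePenalty (A i j / (M + 1 : ℕ))) =
      ((M + 1).factorial : ℝ) ^ 2 * ((∏ j, betheFactor (M + 1) (A i j)) *
        ((A i (σ i) : ℝ) / (M + 1 : ℕ) * bethePenalty (A i (σ i) / (M + 1 : ℕ)))) := by
    intro i
    have hsum := hA.1 i
    rw [← Finset.add_sum_erase _ _ (Finset.mem_univ (σ i))] at hsum
    have h1 : ∀ j ∈ Finset.univ.erase (σ i), betheFactor M (subPermMatrix A σ i j) *
        bethePenalty (A i j / (M + 1 : ℕ)) = betheFactor (M + 1) (A i j) := by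
      intro j hj
      have hne : σ i ≠ j := (Finset.ne_of_mem_erase hj).symm
      have hle : A i j ≤ ∑ j ∈ Finset.univ.erase (σ i), A i j :=
        Finset.single_le_sum (f := fun j => A i j) (fun _ _ => Nat.zero_le _) hj
      have := h i
      rw [subPermMatrix, if_neg hne, Nat.sub_zero, betheFactor_mul_bethePenalty (by omega)]
    obtain ⟨a, ha⟩ := Nat.exists_eq_succ_of_ne_zero (h i)
    have h2 : subPermMatrix A σ i (σ i) = a := by simp [subPermMatrix, ha]
    rw [← Finset.prod_mul_distrib, ← Finset.mul_prod_erase _ _ (Finset.mem_univ (σ i)),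
      Finset.prod_congr rfl h1, ← Finset.mul_prod_erase _ (fun j => betheFactor (M + 1) (A i j))
      (Finset.mem_univ (σ i)), h2, betheFactor_succ, ha, Nat.factorial_succ]
    push_cast
    ring
  have := Finset.prod_congr (rfl : (Finset.univ : Finset ι) = Finset.univ) fun i _ => hrow i
  simp only [Finset.prod_mul_distrib, Finset.prod_const, Finset.card_univ] at this
  simp only [betheCoeff, Finset.prod_mul_distrib]
  linarith

/-- Schrijver's inequality for `A / (M + 1)`, divided by the product of penalties, which is positive
because `bethePenalty 1 = 1`. -/
theorem betheCoeff_succ_le {M : ℕ} {A : ι → ι → ℕ} (hA : A ∈ lineSumMatrices ι (M + 1)) :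
    betheCoeff (M + 1) A ≤
      ∑ σ : Equiv.Perm ι with ∀ i, A i (σ i) ≠ 0, betheCoeff M (subPermMatrix A σ) := by
  have hM : ((M + 1 : ℕ) : ℝ) ≠ 0 := by positivity
  have hA' := mem_lineSumMatrices.1 hA
  have hsch := prod_bethePenalty_le_permanent (A := fun i j => (A i j : ℝ) / (M + 1 : ℕ))
    (fun i j => by positivity)
    (fun i => by rw [← Finset.sum_div, ← Nat.cast_sum, hA'.1, div_self hM])
    (fun i => by rw [← Finset.sum_div, ← Nat.cast_sum, hA'.2, div_self hM])
  have hle1 : ∀ i j, (A i j : ℝ) / (M + 1 : ℕ) ≤ 1 := fun i j => by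
    rw [div_le_one (by positivity)]
    exact_mod_cast
      (Finset.single_le_sum (fun _ _ => Nat.zero_le _) (Finset.mem_univ j)).trans_eq (hA'.1 i)
  have hpos : 0 < ∏ i, ∏ j, bethePenalty ((A i j : ℝ) / (M + 1 : ℕ)) :=
    Finset.prod_pos fun i _ => Finset.prod_pos fun j _ => bethePenalty_pos (hle1 i j)
  -- `Matrix.permanent` takes the entries `(σ i, i)`; transposing gives `(i, σ i)`.
  rw [← Matrix.permanent_transpose, Matrix.permanent] at hsch
  simp only [Matrix.transpose_apply, Matrix.of_apply] at hsch
  refine le_of_mul_le_mul_right ?_ hpos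
  rw [Finset.sum_mul, Finset.sum_congr rfl fun σ hσ =>
    betheCoeff_subPermMatrix hA (Finset.mem_filter.1 hσ).2, ← Finset.mul_sum]
  refine mul_le_mul_of_nonneg_left (hsch.trans (le_of_eq ?_)) (betheCoeff_nonneg _ _)
  symm
  refine Finset.sum_filter_of_ne fun σ _ hσ i h0 => hσ ?_
  exact Finset.prod_eq_zero (Finset.mem_univ i) (by simp [h0])

/-- Apply the coefficient inequality termwise and exchange the sums. For fixed `σ`, `A ↦ A - P_σ` is
injective on matrices whose support contains `σ`, so the inner sum is part of `betheSum M θ`. -/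
theorem betheSum_succ_le {θ : Matrix ι ι ℝ} (hθ : ∀ i j, 0 ≤ θ i j) (M : ℕ) :
    betheSum (M + 1) θ ≤ betheSum M θ * θ.permanent := by
  have hprod : ∀ A : ι → ι → ℕ, 0 ≤ ∏ i, ∏ j, θ i j ^ A i j := fun A =>
    Finset.prod_nonneg fun i _ => Finset.prod_nonneg fun j _ => pow_nonneg (hθ i j) _
  set g : (ι → ι → ℕ) → ℝ := fun A => betheCoeff M A * ∏ i, ∏ j, θ i j ^ A i j with hg
  have hg0 : ∀ A, 0 ≤ g A := fun A => mul_nonneg (betheCoeff_nonneg _ _) (hprod A)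
  calc betheSum (M + 1) θ
      ≤ ∑ A ∈ lineSumMatrices ι (M + 1), ∑ σ : Equiv.Perm ι with ∀ i, A i (σ i) ≠ 0,
          g (subPermMatrix A σ) * ∏ i, θ i (σ i) := by
        refine Finset.sum_le_sum fun A hA => ?_
        refine (mul_le_mul_of_nonneg_right (betheCoeff_succ_le hA) (hprod A)).trans (le_of_eq ?_)
        rw [Finset.sum_mul]
        refine Finset.sum_congr rfl fun σ hσ => ?_
        simp only [hg, mul_assoc]
        congr 1
        rw [← Finset.prod_mul_distrib]
        refine Finset.prod_congr rfl fun i _ => ?_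
        simp only [← subPermMatrix_add (Finset.mem_filter.1 hσ).2 i, pow_add,
          Finset.prod_mul_distrib]
        congr 1
        simp
    _ = ∑ σ : Equiv.Perm ι, (∑ A ∈ lineSumMatrices ι (M + 1) with ∀ i, A i (σ i) ≠ 0,
          g (subPermMatrix A σ)) * ∏ i, θ i (σ i) := by
        simp only [Finset.sum_mul]
        exact Finset.sum_comm' fun A σ => by simp
    _ ≤ ∑ σ : Equiv.Perm ι, betheSum M θ * ∏ i, θ i (σ i) := by
        refine Finset.sum_le_sum fun σ _ => mul_le_mul_of_nonneg_right ?_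
          (Finset.prod_nonneg fun i _ => hθ _ _)
        have hinj : Set.InjOn (fun A => subPermMatrix A σ)
            ({A ∈ lineSumMatrices ι (M + 1) | ∀ i, A i (σ i) ≠ 0} : Finset (ι → ι → ℕ)) := by
          intro A hA B hB hAB
          funext i j
          rw [← subPermMatrix_add (A := A) (Finset.mem_filter.1 hA).2 i j,
            ← subPermMatrix_add (A := B) (Finset.mem_filter.1 hB).2 i j]
          exact congrArg (· + _) (congrFun (congrFun hAB i) j)
        rw [← Finset.sum_image (f := g) hinj]
        refine Finset.sum_le_sum_of_subset_of_nonneg ?_ fun A _ _ => hg0 A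
        intro B hB
        obtain ⟨A, hA, rfl⟩ := Finset.mem_image.1 hB
        exact subPermMatrix_mem (Finset.mem_filter.1 hA).1 (Finset.mem_filter.1 hA).2
    _ = betheSum M θ * θ.permanent := by
        rw [← Finset.mul_sum, ← Matrix.permanent_transpose, Matrix.permanent]
        rfl

theorem betheSum_zero (θ : Matrix ι ι ℝ) : betheSum 0 θ = 1 := by
  have : lineSumMatrices ι 0 = {0} := by
    ext A
    simp only [mem_lineSumMatrices, Finset.sum_eq_zero_iff, Finset.mem_univ, true_implies,
      Finset.mem_singleton]
    refine ⟨fun h => by funext i j; exact h.1 i j, fun h => by simp [h]⟩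
  simp [betheSum, this, betheCoeff, betheFactor_zero]

theorem permanent_nonneg {θ : Matrix ι ι ℝ} (hθ : ∀ i j, 0 ≤ θ i j) : 0 ≤ θ.permanent :=
  Finset.sum_nonneg fun _ _ => Finset.prod_nonneg fun _ _ => hθ _ _

theorem betheSum_le_permanent_pow {θ : Matrix ι ι ℝ} (hθ : ∀ i j, 0 ≤ θ i j) (M : ℕ) :
    betheSum M θ ≤ θ.permanent ^ M := by
  induction M with
  | zero => simp [betheSum_zero]
  | succ M ih =>
    rw [pow_succ]
    exact (betheSum_succ_le hθ M).trans (mul_le_mul_of_nonneg_right ih (permanent_nonneg hθ))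

end BetheSum

/-! ### Counting permutations and liftings of a given block type -/

section Counting

open Nat

/-- Composing with the inverse of one solution fixes every point of `p`, leaving a permutation of
the complement. -/
theorem card_perm_extending_le {κ : Type*} [Fintype κ] [DecidableEq κ] (p : κ → Prop)
    [DecidablePred p] (g : κ → κ) :
    Fintype.card {π : Equiv.Perm κ // ∀ a, p a → π a = g a} ≤
      (Fintype.card κ - Fintype.card {a // p a})! := by
  rcases isEmpty_or_nonempty {π : Equiv.Perm κ // ∀ a, p a → π a = g a} with h | ⟨⟨π₀, h₀⟩⟩
  · simp
  · rw [← Fintype.card_subtype_compl, ← Fintype.card_perm,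
      Fintype.card_congr (Equiv.Perm.subtypeEquivSubtypePerm fun a => ¬ p a)]
    refine Fintype.card_le_of_injective
      (fun π => ⟨π₀⁻¹ * π.1, fun a ha => ?_⟩) fun π π' h => ?_
    · rw [Equiv.Perm.mul_apply, π.2 a (not_not.1 ha), ← h₀ a (not_not.1 ha)]
      simp
    · exact Subtype.ext (mul_left_cancel (Subtype.ext_iff.1 h))

/-- Two solutions differ by a permutation preserving each block. -/
theorem card_perm_fst_eq_le {ι κ : Type*} [Fintype ι] [DecidableEq ι] [Fintype κ] [DecidableEq κ]
    (f : ι × κ → ι) :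
    Fintype.card {σ : Equiv.Perm (ι × κ) // ∀ r, (σ r).1 = f r} ≤
      (Fintype.card κ)! ^ Fintype.card ι := by
  rcases isEmpty_or_nonempty {σ : Equiv.Perm (ι × κ) // ∀ r, (σ r).1 = f r} with h | ⟨⟨σ₀, h₀⟩⟩
  · rw [Fintype.card_eq_zero]
    exact Nat.zero_le _
  · have hst := DomMulAct.stabilizer_card (Prod.fst : ι × κ → ι)
    have hfib : ∀ i : ι, Fintype.card {r : ι × κ // r.1 = i} = Fintype.card κ := fun i =>
      Fintype.card_congr
        ⟨fun r => r.1.2, fun k => ⟨(i, k), rfl⟩, fun ⟨⟨_, _⟩, h⟩ => by subst h; rfl, fun _ => rfl⟩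
    simp only [hfib, Finset.prod_const, Finset.card_univ] at hst
    rw [← hst]
    refine Fintype.card_le_of_injective
      (fun σ => ⟨σ.1 * σ₀⁻¹, funext fun r => ?_⟩) fun σ σ' h => ?_
    · have h1 := h₀ (σ₀⁻¹ r)
      have h2 := σ.2 (σ₀⁻¹ r)
      simp only [Function.comp_apply, Equiv.Perm.mul_apply]
      rw [h2, ← h1]
      simp
    · exact Subtype.ext (mul_right_cancel (Subtype.ext_iff.1 h))

/-- Orbit-stabilizer: colorings with equal class sizes form one orbit, and `∏ j, (a j)!` is the
order of a stabilizer. -/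
theorem card_coloring_mul_le {ι κ : Type*} [Fintype ι] [DecidableEq ι] [Fintype κ] [DecidableEq κ]
    (a : ι → ℕ) :
    Fintype.card {g : κ → ι // ∀ j, Fintype.card {k // g k = j} = a j} * ∏ j, (a j)! ≤
      (Fintype.card κ)! := by
  rcases isEmpty_or_nonempty {g : κ → ι // ∀ j, Fintype.card {k // g k = j} = a j} with
    h | ⟨⟨g₀, h₀⟩⟩
  · simp
  · have hex : ∀ g : {g : κ → ι // ∀ j, Fintype.card {k // g k = j} = a j},
        ∃ π : Equiv.Perm κ, g₀ ∘ π = g.1 := by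
      rintro ⟨g, hg⟩
      refine ⟨(Equiv.sigmaFiberEquiv g).symm.trans
        ((Equiv.sigmaCongrRight fun j => Fintype.equivOfCardEq ((hg j).trans (h₀ j).symm)).trans
          (Equiv.sigmaFiberEquiv g₀)), funext fun k => ?_⟩
      exact (Fintype.equivOfCardEq ((hg (g k)).trans (h₀ (g k)).symm) ⟨k, rfl⟩).2
    choose π hπ using hex
    have hst := DomMulAct.stabilizer_card g₀
    simp only [h₀] at hst
    rw [← hst, ← Fintype.card_prod, ← Fintype.card_perm]
    refine Fintype.card_le_of_injective (fun x => x.2.1 * π x.1) ?_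
    rintro ⟨g, h, hh⟩ ⟨g', h', hh'⟩ heq
    have hgg : g = g' := by
      refine Subtype.ext ?_
      rw [← hπ g, ← hπ g']
      calc g₀ ∘ π g = (g₀ ∘ h) ∘ π g := by rw [hh]
        _ = (g₀ ∘ h') ∘ π g' := congrArg (fun s : Equiv.Perm κ => g₀ ∘ s) heq
        _ = g₀ ∘ π g' := by rw [hh']
    subst hgg
    simpa using heq

/-- The number of rows of block `i` that `σ` sends to block `j`. -/
def blockType {ι κ : Type*} [DecidableEq ι] [Fintype κ] (σ : Equiv.Perm (ι × κ)) (i j : ι) : ℕ :=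
  Fintype.card {a : κ // (σ (i, a)).1 = j}

variable {ι κ : Type*} [Fintype ι] [DecidableEq ι] [Fintype κ] [DecidableEq κ]

omit [DecidableEq κ] in
theorem blockType_mem (σ : Equiv.Perm (ι × κ)) :
    blockType σ ∈ lineSumMatrices ι (Fintype.card κ) := by
  refine mem_lineSumMatrices.2 ⟨fun i => ?_, fun j => ?_⟩
  · simp only [blockType]
    rw [← Fintype.card_sigma]
    exact Fintype.card_congr (Equiv.sigmaFiberEquiv fun a => (σ (i, a)).1)
  · simp only [blockType]
    rw [← Fintype.card_sigma]
    refine Fintype.card_congr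
      ⟨fun x => (σ (x.1, x.2.1)).2,
        fun b => ⟨(σ.symm (j, b)).1, (σ.symm (j, b)).2, by simp⟩, ?_, fun b => by simp⟩
    rintro ⟨i, a, h⟩
    have h1 : (j, (σ (i, a)).2) = σ (i, a) := Prod.ext h.symm rfl
    have h2 : σ.symm (j, (σ (i, a)).2) = (i, a) := by rw [h1, Equiv.symm_apply_apply]
    refine Sigma.ext (congrArg Prod.fst h2) ?_
    refine (Subtype.heq_iff_coe_eq fun x => ?_).2 (congrArg Prod.snd h2)
    have h3 := congrArg Prod.fst h2
    dsimp only at h3 ⊢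
    rw [h3]

/-- First choose the target block of every row, a multinomial count for each `i`; then at most
`(card κ)!` to the `card ι` permutations realize that choice. -/
theorem card_blockType_eq_mul_le (A : ι → ι → ℕ) :
    Fintype.card {σ : Equiv.Perm (ι × κ) // blockType σ = A} * ∏ i, ∏ j, (A i j)! ≤
      ((Fintype.card κ)! ^ 2) ^ Fintype.card ι := by
  have h1 : Fintype.card {σ : Equiv.Perm (ι × κ) // blockType σ = A} ≤
      (Fintype.card κ)! ^ Fintype.card ι *
        ∏ i, Fintype.card {g : κ → ι // ∀ j, Fintype.card {k // g k = j} = A i j} := by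
    rw [← Fintype.card_pi, ← Finset.card_univ, ← Finset.card_univ]
    refine Finset.card_le_mul_card_image_of_maps_to
      (f := fun (σ : {σ : Equiv.Perm (ι × κ) // blockType σ = A}) (i : ι) =>
        (⟨fun a => (σ.1 (i, a)).1, fun j => congrFun (congrFun σ.2 i) j⟩ :
          {g : κ → ι // ∀ j, Fintype.card {k // g k = j} = A i j}))
      (fun _ _ => Finset.mem_univ _) _ fun f _ => ?_
    refine le_trans ?_ (card_perm_fst_eq_le fun r => (f r.1).1 r.2)
    rw [← Fintype.card_subtype]
    refine Fintype.card_le_of_injective (fun σ => ⟨σ.1.1, fun r => ?_⟩) fun σ σ' h => ?_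
    · exact congrFun (congrArg Subtype.val (congrFun σ.2 r.1)) r.2
    · exact Subtype.ext (Subtype.ext (Subtype.mk.inj h))
  calc _ ≤ (Fintype.card κ)! ^ Fintype.card ι *
        (∏ i, Fintype.card {g : κ → ι // ∀ j, Fintype.card {k // g k = j} = A i j}) *
          ∏ i, ∏ j, (A i j)! := Nat.mul_le_mul_right _ h1
    _ = (Fintype.card κ)! ^ Fintype.card ι *
        ∏ i, (Fintype.card {g : κ → ι // ∀ j, Fintype.card {k // g k = j} = A i j} *
          ∏ j, (A i j)!) := by rw [Finset.prod_mul_distrib, mul_assoc]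
    _ ≤ (Fintype.card κ)! ^ Fintype.card ι * ∏ _i : ι, (Fintype.card κ)! :=
        Nat.mul_le_mul_left _ (Finset.prod_le_prod' fun i _ => card_coloring_mul_le (A i))
    _ = ((Fintype.card κ)! ^ 2) ^ Fintype.card ι := by
        rw [Finset.prod_const, Finset.card_univ, ← pow_add, ← pow_mul, two_mul]

/-- Compatibility with `σ` prescribes `P i j` at exactly `blockType σ i j` points. -/
theorem card_compatible_le (σ : Equiv.Perm (ι × κ)) :
    Fintype.card {P : ι → ι → Equiv.Perm κ // ∀ r, P r.1 (σ r).1 r.2 = (σ r).2} ≤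
      ∏ i, ∏ j, (Fintype.card κ - blockType σ i j)! := by
  calc _ ≤ Fintype.card (∀ i j, {π : Equiv.Perm κ //
        ∀ a, (σ (i, a)).1 = j → π a = (σ (i, a)).2}) := by
        refine Fintype.card_le_of_injective
          (fun P i j => ⟨P.1 i j, fun a ha => ?_⟩) fun P Q h => ?_
        · subst ha; exact P.2 (i, a)
        · exact Subtype.ext (funext fun i => funext fun j =>
            congrArg Subtype.val (congrFun (congrFun h i) j))
    _ = ∏ i, ∏ j, Fintype.card {π : Equiv.Perm κ //
        ∀ a, (σ (i, a)).1 = j → π a = (σ (i, a)).2} := by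
        simp only [Fintype.card_pi]
    _ ≤ _ := Finset.prod_le_prod' fun i _ => Finset.prod_le_prod' fun j _ =>
        card_perm_extending_le _ _

end Counting

open Nat in
theorem averageLiftPermanent_le_betheSum {m : ℕ} (M : ℕ) {θ : Matrix (Fin m) (Fin m) ℝ}
    (hθ : ∀ i j, 0 ≤ θ i j) : averageLiftPermanent M θ ≤ betheSum M θ := by
  have hcard : (Fintype.card (Fin m → Fin m → Equiv.Perm (Fin M)) : ℝ) =
      ∏ _i : Fin m, ∏ _j : Fin m, (M ! : ℝ) := by
    simp [Fintype.card_perm]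
  have hcard0 : 0 < ∏ _i : Fin m, ∏ _j : Fin m, (M ! : ℝ) :=
    Finset.prod_pos fun _ _ => Finset.prod_pos fun _ _ => by positivity
  have hpow : ∀ A : Fin m → Fin m → ℕ, 0 ≤ ∏ i, ∏ j, θ i j ^ A i j := fun A =>
    Finset.prod_nonneg fun i _ => Finset.prod_nonneg fun j _ => pow_nonneg (hθ i j) _
  set G : (Fin m → Fin m → ℕ) → ℝ := fun A =>
    (∏ i, ∏ j, θ i j ^ A i j) * ∏ i, ∏ j, ((M - A i j)! : ℝ) with hG
  have hG0 : ∀ A, 0 ≤ G A := fun A => mul_nonneg (hpow A) (by positivity)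
  rw [averageLiftPermanent, hcard, div_le_iff₀ hcard0]
  have hterm : ∀ σ : Equiv.Perm (Fin m × Fin M),
      ∑ P : Fin m → Fin m → Equiv.Perm (Fin M), ∏ r, matrixLift θ P r (σ r) ≤ G (blockType σ) := by
    intro σ
    -- The term of `σ` vanishes unless `P` is compatible with `σ`; otherwise it depends only on the
    -- block type.
    have h1 : ∀ P : Fin m → Fin m → Equiv.Perm (Fin M), ∏ r, matrixLift θ P r (σ r) =
        (∏ i, ∏ j, θ i j ^ blockType σ i j) *
          if ∀ r, P r.1 (σ r).1 r.2 = (σ r).2 then 1 else 0 := by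
      intro P
      simp only [matrixLift, Matrix.of_apply, Finset.prod_mul_distrib]
      congr 1
      · rw [Fintype.prod_prod_type]
        refine Finset.prod_congr rfl fun i _ => ?_
        rw [← Finset.prod_fiberwise Finset.univ fun a => (σ (i, a)).1]
        refine Finset.prod_congr rfl fun j _ => ?_
        refine (Finset.prod_congr rfl (g := fun _ => θ i j) fun a ha => by
          rw [(Finset.mem_filter.1 ha).2]).trans ?_
        rw [Finset.prod_const, blockType, Fintype.card_subtype]
      · have hbool := Finset.prod_boole (s := Finset.univ) (M₀ := ℝ)
          (p := fun r : Fin m × Fin M => P r.1 (σ r).1 r.2 = (σ r).2)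
        simp only [Finset.mem_univ, true_implies] at hbool
        rw [← hbool]
        refine Finset.prod_congr rfl fun r _ => ?_
        simp [Equiv.Perm.permMatrix, PEquiv.toMatrix_apply, Equiv.toPEquiv_apply, eq_comm]
    simp only [h1]
    rw [← Finset.mul_sum, Finset.sum_boole, ← Fintype.card_subtype]
    refine mul_le_mul_of_nonneg_left ?_ (hpow _)
    have := card_compatible_le σ
    rw [Fintype.card_fin] at this
    exact_mod_cast this
  calc ∑ P : Fin m → Fin m → Equiv.Perm (Fin M), (matrixLift θ P).permanent
      = ∑ σ : Equiv.Perm (Fin m × Fin M),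
          ∑ P : Fin m → Fin m → Equiv.Perm (Fin M), ∏ r, matrixLift θ P r (σ r) := by
        rw [Finset.sum_comm]
        refine Finset.sum_congr rfl fun P _ => ?_
        rw [← Matrix.permanent_transpose, Matrix.permanent]
        rfl
    _ ≤ ∑ σ : Equiv.Perm (Fin m × Fin M), G (blockType σ) := Finset.sum_le_sum fun σ _ => hterm σ
    _ = ∑ A ∈ lineSumMatrices (Fin m) M,
          (Fintype.card {σ : Equiv.Perm (Fin m × Fin M) // blockType σ = A} : ℝ) * G A := by
        rw [← Finset.sum_fiberwise_of_maps_to (t := lineSumMatrices (Fin m) M) (g := blockType)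
          fun σ _ => by simpa using blockType_mem σ]
        refine Finset.sum_congr rfl fun A _ => ?_
        rw [Finset.sum_congr rfl fun σ hσ => by rw [(Finset.mem_filter.1 hσ).2],
          Finset.sum_const, nsmul_eq_mul, Fintype.card_subtype]
    _ ≤ betheSum M θ * ∏ _i : Fin m, ∏ _j : Fin m, (M ! : ℝ) := by
        rw [betheSum, Finset.sum_mul]
        refine Finset.sum_le_sum fun A _ => ?_
        have h2 := card_blockType_eq_mul_le (κ := Fin M) A
        simp only [Fintype.card_fin] at h2
        have h3 : (Fintype.card {σ : Equiv.Perm (Fin m × Fin M) // blockType σ = A} : ℝ) *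
            ∏ i, ∏ j, ((A i j)! : ℝ) ≤ ((M ! : ℝ) ^ 2) ^ m := by exact_mod_cast h2
        have h4 : 0 < ∏ i, ∏ j, ((A i j)! : ℝ) := by positivity
        have h5 : betheCoeff M A * ∏ _i : Fin m, ∏ _j : Fin m, (M ! : ℝ) =
            ((M ! : ℝ) ^ 2) ^ m / (∏ i, ∏ j, ((A i j)! : ℝ)) *
              ∏ i, ∏ j, ((M - A i j)! : ℝ) := by
          simp only [betheCoeff, betheFactor, Finset.prod_div_distrib, Finset.prod_mul_distrib,
            Fintype.card_fin]
          field_simp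
        rw [← le_div_iff₀ h4] at h3
        calc _ ≤ ((M ! : ℝ) ^ 2) ^ m / (∏ i, ∏ j, ((A i j)! : ℝ)) * G A :=
              mul_le_mul_of_nonneg_right h3 (hG0 A)
          _ = betheCoeff M A * (∏ i, ∏ j, θ i j ^ A i j) *
                ∏ _i : Fin m, ∏ _j : Fin m, (M ! : ℝ) := by
              rw [mul_right_comm, h5]; simp only [hG]; ring

/-! ### Lifting a single term of the Bethe sum -/

section Lift

variable {m M : ℕ}

/-- The lifting of a matrix of natural numbers. -/
def natLift (A : Fin m → Fin m → ℕ) (P : Fin m → Fin m → Equiv.Perm (Fin M)) :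
    Fin m × Fin M → Fin m × Fin M → ℕ :=
  fun r c => if P r.1 c.1 r.2 = c.2 then A r.1 c.1 else 0

theorem natLift_mem {N : ℕ} {A : Fin m → Fin m → ℕ} (hA : A ∈ lineSumMatrices (Fin m) N)
    (P : Fin m → Fin m → Equiv.Perm (Fin M)) :
    natLift A P ∈ lineSumMatrices (Fin m × Fin M) N := by
  rw [mem_lineSumMatrices] at hA ⊢
  refine ⟨fun r => ?_, fun c => ?_⟩
  · simp [natLift, Fintype.sum_prod_type, hA.1]
  · simp [natLift, Fintype.sum_prod_type, ← Equiv.eq_symm_apply, hA.2]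

theorem prod_lift_eq_pow (g : Fin m → Fin m → ℝ) (P : Fin m → Fin m → Equiv.Perm (Fin M)) :
    ∏ r : Fin m × Fin M, ∏ c : Fin m × Fin M,
      (if P r.1 c.1 r.2 = c.2 then g r.1 c.1 else 1) = (∏ i, ∏ j, g i j) ^ M := by
  simp [Fintype.prod_prod_type, Finset.prod_pow]

theorem betheCoeff_natLift (N : ℕ) (A : Fin m → Fin m → ℕ)
    (P : Fin m → Fin m → Equiv.Perm (Fin M)) :
    betheCoeff N (natLift A P) = betheCoeff N A ^ M := by
  have h : ∀ r c, betheFactor N (natLift A P r c) =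
      if P r.1 c.1 r.2 = c.2 then betheFactor N (A r.1 c.1) else 1 := fun r c => by
    unfold natLift; split_ifs
    · rfl
    · exact betheFactor_zero N
  simp only [betheCoeff, h]
  rw [prod_lift_eq_pow fun i j => betheFactor N (A i j), mul_pow, ← pow_mul _ _ M]
  simp only [Fintype.card_prod, Fintype.card_fin]

theorem prod_matrixLift_pow_natLift (θ : Matrix (Fin m) (Fin m) ℝ) (A : Fin m → Fin m → ℕ)
    (P : Fin m → Fin m → Equiv.Perm (Fin M)) :
    ∏ r, ∏ c, matrixLift θ P r c ^ natLift A P r c = (∏ i, ∏ j, θ i j ^ A i j) ^ M := by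
  rw [← prod_lift_eq_pow (fun i j => θ i j ^ A i j) P]
  refine Finset.prod_congr rfl fun r _ => Finset.prod_congr rfl fun c _ => ?_
  unfold natLift
  split_ifs with h
  · simp [matrixLift, Equiv.Perm.permMatrix, PEquiv.toMatrix_apply, Equiv.toPEquiv_apply, h]
  -- Off the support of the lifting the factor is `0 ^ 0 = 1`.
  · simp

theorem matrixLift_nonneg {θ : Matrix (Fin m) (Fin m) ℝ} (hθ : ∀ i j, 0 ≤ θ i j)
    (P : Fin m → Fin m → Equiv.Perm (Fin M)) (r c : Fin m × Fin M) : 0 ≤ matrixLift θ P r c := by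
  simp only [matrixLift, Matrix.of_apply, Equiv.Perm.permMatrix, PEquiv.toMatrix_apply]
  refine mul_nonneg (hθ _ _) ?_
  split_ifs <;> norm_num

/-- The left side is the term of `natLift A P` in the degree-`N` Bethe sum of the lifting; the other
terms are nonnegative. -/
theorem betheTerm_pow_le_permanent_pow {θ : Matrix (Fin m) (Fin m) ℝ} (hθ : ∀ i j, 0 ≤ θ i j)
    {N : ℕ} {A : Fin m → Fin m → ℕ} (hA : A ∈ lineSumMatrices (Fin m) N)
    (P : Fin m → Fin m → Equiv.Perm (Fin M)) :
    (betheCoeff N A * ∏ i, ∏ j, θ i j ^ A i j) ^ M ≤ (matrixLift θ P).permanent ^ N := by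
  refine le_trans ?_ (betheSum_le_permanent_pow (matrixLift_nonneg hθ P) N)
  rw [mul_pow, ← betheCoeff_natLift N A P, ← prod_matrixLift_pow_natLift θ A P]
  exact Finset.single_le_sum
    (f := fun B => betheCoeff N B * ∏ r, ∏ c, matrixLift θ P r c ^ B r c)
    (fun B _ => mul_nonneg (betheCoeff_nonneg _ _) (Finset.prod_nonneg fun _ _ =>
      Finset.prod_nonneg fun _ _ => pow_nonneg (matrixLift_nonneg hθ P _ _) _))
    (natLift_mem hA P)

theorem averageLiftPermanent_nonneg {θ : Matrix (Fin m) (Fin m) ℝ} (hθ : ∀ i j, 0 ≤ θ i j) :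
    0 ≤ averageLiftPermanent M θ :=
  div_nonneg (Finset.sum_nonneg fun P _ => permanent_nonneg (matrixLift_nonneg hθ P))
    (Nat.cast_nonneg _)

theorem le_averageLiftPermanent_of_forall {θ : Matrix (Fin m) (Fin m) ℝ} {x : ℝ}
    (h : ∀ P : Fin m → Fin m → Equiv.Perm (Fin M), x ≤ (matrixLift θ P).permanent) :
    x ≤ averageLiftPermanent M θ := by
  rw [averageLiftPermanent, le_div_iff₀ (by exact_mod_cast Fintype.card_pos), mul_comm,
    ← nsmul_eq_mul, ← Finset.card_univ]
  exact Finset.card_nsmul_le_sum _ _ _ fun P _ => h P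

end Lift

/-! ### Comparison of degrees and passage to the limit -/

theorem degreeBethePermanent_le_permanent {m : ℕ} {θ : Matrix (Fin m) (Fin m) ℝ}
    (hθ : ∀ i j, 0 ≤ θ i j) {M : ℕ} (hM : 1 ≤ M) :
    degreeBethePermanent M θ ≤ θ.permanent := by
  rw [degreeBethePermanent, one_div, Real.rpow_inv_le_iff_of_pos (averageLiftPermanent_nonneg hθ)
    (permanent_nonneg hθ) (by exact_mod_cast hM), Real.rpow_natCast]
  exact (averageLiftPermanent_le_betheSum M hθ).trans (betheSum_le_permanent_pow hθ M)

/-- Each term of `betheSum N θ` is at most the `N`-th power of the degree-`M` Bethe permanent; the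
prefactor is the `N`-th root of the bound on the number of terms. -/
theorem degreeBethePermanent_le_mul {m : ℕ} {θ : Matrix (Fin m) (Fin m) ℝ}
    (hθ : ∀ i j, 0 ≤ θ i j) {M N : ℕ} (hM : 1 ≤ M) (hN : 1 ≤ N) :
    degreeBethePermanent N θ ≤
      ((N : ℝ) + 1) ^ (((m * m : ℕ) : ℝ) / (N : ℝ)) * degreeBethePermanent M θ := by
  have hM0 : (0 : ℝ) < M := by exact_mod_cast hM
  have hN0 : (0 : ℝ) < N := by exact_mod_cast hN
  set K : ℝ := ((N : ℝ) + 1) ^ (m * m) with hK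
  have hK0 : 0 < K := by positivity
  have hterm : ∀ A : Fin m → Fin m → ℕ, 0 ≤ betheCoeff N A * ∏ i, ∏ j, θ i j ^ A i j := fun A =>
    mul_nonneg (betheCoeff_nonneg _ _) (Finset.prod_nonneg fun _ _ =>
      Finset.prod_nonneg fun _ _ => pow_nonneg (hθ _ _) _)
  have hmax : ∀ A ∈ lineSumMatrices (Fin m) N, betheCoeff N A * ∏ i, ∏ j, θ i j ^ A i j ≤
      degreeBethePermanent M θ ^ N := by
    intro A hA
    have h1 : (betheCoeff N A * ∏ i, ∏ j, θ i j ^ A i j) ^ ((M : ℝ) / N) ≤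
        averageLiftPermanent M θ := by
      refine le_averageLiftPermanent_of_forall fun P => ?_
      have h2 := betheTerm_pow_le_permanent_pow hθ hA P
      rw [div_eq_mul_inv, Real.rpow_mul (hterm A), Real.rpow_natCast,
        Real.rpow_inv_le_iff_of_pos (pow_nonneg (hterm A) _)
          (permanent_nonneg (matrixLift_nonneg hθ P)) hN0, Real.rpow_natCast]
      exact h2
    have h3 := Real.rpow_le_rpow (Real.rpow_nonneg (hterm A) _) h1
      (by positivity : (0 : ℝ) ≤ (N : ℝ) / M)
    rw [← Real.rpow_mul (hterm A), div_mul_div_cancel₀ hN0.ne', div_self hM0.ne',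
      Real.rpow_one] at h3
    refine h3.trans (le_of_eq ?_)
    rw [degreeBethePermanent, ← Real.rpow_natCast, ← Real.rpow_mul (averageLiftPermanent_nonneg hθ)]
    congr 1
    ring
  have hM_nonneg : 0 ≤ degreeBethePermanent M θ :=
    Real.rpow_nonneg (averageLiftPermanent_nonneg hθ) _
  have hsum : averageLiftPermanent N θ ≤ K * degreeBethePermanent M θ ^ N := by
    refine (averageLiftPermanent_le_betheSum N hθ).trans
      ((Finset.sum_le_card_nsmul _ _ _ hmax).trans ?_)
    rw [nsmul_eq_mul]
    refine mul_le_mul_of_nonneg_right ?_ (pow_nonneg hM_nonneg _)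
    have := card_lineSumMatrices_le (ι := Fin m) N
    rw [Fintype.card_fin] at this
    rw [hK]
    exact_mod_cast this
  rw [degreeBethePermanent, one_div, Real.rpow_inv_le_iff_of_pos (averageLiftPermanent_nonneg hθ)
    (mul_nonneg (by positivity) hM_nonneg) hN0, Real.rpow_natCast, mul_pow, ← Real.rpow_natCast
    (((N : ℝ) + 1) ^ _), ← Real.rpow_mul (by positivity), div_mul_cancel₀ _ hN0.ne',
    Real.rpow_natCast]
  exact hsum

theorem bethePermanent_le_degreeBethePermanent {m : ℕ} {θ : Matrix (Fin m) (Fin m) ℝ}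
    (hθ : ∀ i j, 0 ≤ θ i j) {M : ℕ} (hM : 1 ≤ M) :
    bethePermanent θ ≤ ((degreeBethePermanent M θ : ℝ) : EReal) := by
  have h1 : Filter.Tendsto
      (fun N : ℕ => ((N : ℝ) + 1) ^ (((m * m : ℕ) : ℝ) / (N : ℝ))) Filter.atTop (nhds 1) := by
    -- With `x = N + 1`, the exponent `m² / (x - 1)` is `m² / N`.
    have h := (tendsto_rpow_div_mul_add ((m * m : ℕ) : ℝ) 1 (-1) zero_ne_one).comp
      (Filter.tendsto_atTop_add_const_right _ (1 : ℝ) tendsto_natCast_atTop_atTop)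
    refine h.congr fun N => ?_
    simp only [Function.comp_apply]
    congr 2
    ring
  have h2 := h1.mul_const (degreeBethePermanent M θ)
  rw [one_mul] at h2
  have h3 := (continuous_coe_real_ereal.tendsto _).comp h2
  rw [bethePermanent, ← h3.limsup_eq]
  refine Filter.limsup_le_limsup ?_
  filter_upwards [Filter.eventually_ge_atTop 1] with N hN
  exact EReal.coe_le_coe_iff.2 (degreeBethePermanent_le_mul hθ hM hN)

theorem theorem3 (m : ℕ) (θ : Matrix (Fin m) (Fin m) ℝ) (hθ : ∀ i j, 0 ≤ θ i j)
    (M : ℕ) (hM : 1 ≤ M) :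
    bethePermanent θ ≤ ((degreeBethePermanent M θ : ℝ) : EReal) ∧
      degreeBethePermanent M θ ≤ θ.permanent ∧
      bethePermanent θ ≤ ((θ.permanent : ℝ) : EReal) :=
  ⟨bethePermanent_le_degreeBethePermanent hθ hM, degreeBethePermanent_le_permanent hθ hM,
    (bethePermanent_le_degreeBethePermanent hθ hM).trans
      (EReal.coe_le_coe_iff.2 (degreeBethePermanent_le_permanent hθ hM))⟩
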